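/- Let $X$ be a set, let $\mathcal A,\mathcal B$ be unital $C^*$-algebras, let $\mathcal L(\mathcal A,\mathcal B)$ be the space of bounded linear maps $\mathcal A\to\mathcal B$, and let a kernel mean a map $X\times X\to\mathcal L(\mathcal A,\mathcal B)$. A kernel $k$ is completely positive if $\sum_{i,j=1}^n b_i^*\,k(x_i,x_j)[a_i^*a_j]\,b_j\ge 0$ for every finite choice $(x_i,a_i,b_i)_{i=1}^n$ in $X\times\mathcal A\times\mathcal B$; write $k_1\le k_2$ if $k_2-k_1$ is completely positive. An $(\mathcal A,\mathcal B)$-correspondence is a (complete) right Hilbert $C^*$-module over $\mathcal B$, with $\mathcal B$-valued inner product $\langle\cdot,\cdot\rangle$ linear in the first variable, together with a unital $*$-representation of $\mathcal A$ on it by adjointable operators, written as a left action $a\cdot e$. **Theorem.** For a kernel $k: X\times X\to\mathcal L(\mathcal A,\mathcal B)$ the following are equivalent: 1. $k$ is the difference of two completely positive kernels. 2. There is a completely positive kernel $L$ such that $k\le L$. 3. There is a completely positive kernel $L$ such that $-L\le k\le L$. 4. There are an $(\mathcal A,\mathcal B)$-correspondence $E$, a self-adjoint contractive left $\mathcal A$-module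 map $J:E\to E$, and a map $\iota:X\to E$ such that $k(x,y)[a]=\langle a\cdot\iota(y),\,J\iota(x)\rangle$ for all $x,y\in X$ and $a\in\mathcal A$. 5. There are an $(\mathcal A,\mathcal B)$-correspondence $E$, a self-adjoint contractive left $\mathcal A$-module map $J:E\to E$ with $J^2=I_E$, and a map $\iota:X\to E$ such that $k(x,y)[a]=\langle a\cdot\iota(y),\,J\iota(x)\rangle$ for all $x,y\in X$ and $a\in\mathcal A$. -/

import Mathlib

open scoped RightActions

universe u v w t

/-- The `L(A, B)`-valued kernels on a set `X`: maps from `X × X` to the bounded linear maps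
from `A` to `B`. -/
abbrev OperatorKernel (X : Type u) (A : Type v) (B : Type w) [CStarAlgebra A] [CStarAlgebra B] :
    Type (max u v w) :=
  X → X → A →L[ℂ] B

namespace OperatorKernel

variable {X : Type u} {A : Type v} {B : Type w} [CStarAlgebra A] [CStarAlgebra B]
  [PartialOrder B]

/-- A kernel `k` is completely positive if `∑ i j, bᵢ⋆ k(xᵢ, xⱼ)[aᵢ⋆ aⱼ] bⱼ ≥ 0` for every finite
choice of triples `(xᵢ, aᵢ, bᵢ)` in `X × A × B`. -/
def IsCompletelyPositive (k : OperatorKernel X A B) : Prop :=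
  ∀ (n : ℕ) (x : Fin n → X) (a : Fin n → A) (b : Fin n → B),
    0 ≤ ∑ i, ∑ j, star (b i) * k (x i) (x j) (star (a i) * a j) * b j

/-- The order on kernels: `k₁ ≤ k₂` if `k₂ - k₁` is completely positive. -/
def KernelLE (k₁ k₂ : OperatorKernel X A B) : Prop :=
  IsCompletelyPositive (k₂ - k₁)

/-- A kernel is decomposable if it is the difference of two completely positive kernels. -/
def IsDecomposable (k : OperatorKernel X A B) : Prop :=
  ∃ k₁ k₂ : OperatorKernel X A B,
    IsCompletelyPositive k₁ ∧ IsCompletelyPositive k₂ ∧ k = k₁ - k₂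

end OperatorKernel

/-- An `(A, B)`-correspondence: a (complete) Hilbert C⋆-module over `B`, with `B` acting on the
right, together with a unital ⋆-representation of `A` on it by adjointable operators, written as
a left action.

Mathlib's class `CStarModule R E` axiomatises modules with `⟪x, r • y⟫ = r * ⟪x, y⟫`; a right
Hilbert `B`-module is therefore such a module over the opposite algebra `Bᵐᵒᵖ`, where this reads
`⟪x, y <• b⟫ = ⟪x, y⟫ * b` in `B`. -/
structure Correspondence (A : Type v) (B : Type w) [CStarAlgebra A] [CStarAlgebra B]
    [PartialOrder B] [StarOrderedRing B] where
  carrier : Type t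
  [instNormedAddCommGroup : NormedAddCommGroup carrier]
  [instNormedSpace : NormedSpace ℂ carrier]
  [instCompleteSpace : CompleteSpace carrier]
  [instRightModule : Module Bᵐᵒᵖ carrier]
  [instCStarModule : CStarModule Bᵐᵒᵖ carrier]
  [instLeftModule : Module A carrier]
  [instIsScalarTower : IsScalarTower ℂ A carrier]
  [instSMulCommClass : SMulCommClass A Bᵐᵒᵖ carrier]
  /-- The left action is a ⋆-representation: `a⋆` acts as the adjoint of `a`. -/
  inner_smul_left' : ∀ (a : A) (e f : carrier),
    inner Bᵐᵒᵖ (a • e) f = inner Bᵐᵒᵖ e (star a • f)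

namespace Correspondence

attribute [instance] instNormedAddCommGroup instNormedSpace instCompleteSpace instRightModule
  instCStarModule instLeftModule instIsScalarTower instSMulCommClass

variable {A : Type v} {B : Type w} [CStarAlgebra A] [CStarAlgebra B]
  [PartialOrder B] [StarOrderedRing B]

instance : CoeSort (Correspondence.{v, w, t} A B) (Type t) := ⟨carrier⟩

/-- The `B`-valued inner product `⟨e, f⟩` of a correspondence, linear in the first variable:
`⟨e <• b, f⟩ = ⟨e, f⟩ * b` and `⟨e, f⟩⋆ = ⟨f, e⟩`. -/
def ip (E : Correspondence.{v, w, t} A B) (e f : E) : B :=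
  MulOpposite.unop (inner Bᵐᵒᵖ f e)

theorem ip_smul_left (E : Correspondence.{v, w, t} A B) (e f : E) (b : B) :
    E.ip (e <• b) f = E.ip e f * b := by
  simp [ip]

theorem star_ip (E : Correspondence.{v, w, t} A B) (e f : E) :
    star (E.ip e f) = E.ip f e := by
  simp [ip, ← MulOpposite.unop_star]

/-- `J` is self-adjoint: `⟨J e, f⟩ = ⟨e, J f⟩`. (Such a `J` is automatically right `B`-linear
and bounded.) -/
def IsSelfAdjointMap (E : Correspondence.{v, w, t} A B) (J : E →ₗ[A] E) : Prop :=
  ∀ e f : E, E.ip (J e) f = E.ip e (J f)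

/-- `J` is contractive: `‖J e‖ ≤ ‖e‖`. -/
def IsContractiveMap (E : Correspondence.{v, w, t} A B) (J : E →ₗ[A] E) : Prop :=
  ∀ e : E, ‖J e‖ ≤ ‖e‖

end Correspondence

/-!
The substantial implication is from a difference `k = k₁ - k₂` of completely positive kernels to a
representation by a self-adjoint involution. Each `kᵢ` has a Kolmogorov decomposition
`kᵢ(x, y)[a] = ⟨a ιᵢ(y), ιᵢ(x)⟩` in a correspondence `Eᵢ`
(`OperatorKernel.IsCompletelyPositive.apply_eq_ip_embedding`); on `E₁ ⊕ E₂` the vectors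
`(ι₁(x), ι₂(x))` and the symmetry `(e, f) ↦ (e, -f)` then represent `k`.

The correspondence of a completely positive kernel `k` is built from finitely supported functions
`X × A → B`, with the semi-inner product given by `((x, a), (y, a')) ↦ k(x, y)[a⋆ a']`. Null vectors
are orthogonal to everything (`CStarSemiInnerForm.form_eq_zero_of_form_self_eq_zero`), so the
quotient by the null space is a pre-Hilbert `B`-module. Left translation by `A` descends to it,
becomes additive in `A` there, and is contractive because `‖a‖² - a⋆a = c⋆c`
(`CStarModule.norm_smul_le_of_inner_smul_left`). Everything therefore extends to the completion.

Conversely, if a self-adjoint contraction `J` represents `k`, let `L` be the kernel represented by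
the identity. Then `L ∓ k` is represented by `1 ∓ J`, and `1 ∓ J ≥ 0` as a statement about
`B`-valued inner products. This rests on `⟨Je, Je⟩ ≤ ⟨e, e⟩` (`CStarModule.inner_map_self_le`), which
follows from convexity of the bounded sequence `⟨Jⁿe, Jⁿe⟩`. The remaining implications are
formal.
-/

/-! ### Inequalities in C⋆-algebras -/

section Order

variable {C : Type*} [CStarAlgebra C] [PartialOrder C] [StarOrderedRing C]

/-- An element whose multiples `n • d` are all dominated by elements of a bounded set is
nonpositive. -/
theorem CStarAlgebra.nonpos_of_forall_nsmul_le {d : C} {u : ℕ → C} {M : ℝ}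
    (hu : ∀ n, ‖u n‖ ≤ M) (h : ∀ n : ℕ, n • d ≤ u n) : d ≤ 0 := by
  have hlim : Filter.Tendsto (fun n : ℕ => ((n : ℝ) + 1)⁻¹ • u (n + 1)) Filter.atTop
      (nhds 0) := by
    refine squeeze_zero_norm (a := fun n : ℕ => ((n : ℝ) + 1)⁻¹ * M) (fun n => ?_) ?_
    · rw [norm_smul, Real.norm_of_nonneg (by positivity)]
      gcongr
      exact hu _
    · simpa [one_div] using (tendsto_one_div_add_atTop_nhds_zero_nat (𝕜 := ℝ)).mul_const M
  refine ge_of_tendsto' hlim fun n => ?_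
  have h1 := smul_le_smul_of_nonneg_left (h (n + 1))
    (show (0 : ℝ) ≤ ((n : ℝ) + 1)⁻¹ by positivity)
  have h2 : ((n : ℝ) + 1)⁻¹ • ((n + 1) • d) = d := by
    rw [← Nat.cast_smul_eq_nsmul ℝ, smul_smul]
    push_cast
    rw [inv_mul_cancel₀ (by positivity), one_smul]
  rwa [h2] at h1

/-- In a unital C⋆-algebra `‖a‖² - a⋆a` has the form `c⋆c`. -/
theorem CStarAlgebra.exists_star_mul_self_add_eq_algebraMap (a : C) :
    ∃ c : C, star c * c + star a * a = algebraMap ℂ C ((‖a‖ : ℂ) ^ 2) := by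
  have h : star a * a ≤ algebraMap ℝ C (‖a‖ ^ 2) := by
    have := (IsSelfAdjoint.star_mul_self a).le_algebraMap_norm_self
    rwa [CStarRing.norm_star_mul_self, ← pow_two] at this
  obtain ⟨c, hc⟩ := CStarAlgebra.nonneg_iff_eq_star_mul_self.mp (sub_nonneg.mpr h)
  refine ⟨c, ?_⟩
  rw [← hc, sub_add_cancel, IsScalarTower.algebraMap_apply ℝ ℂ C]
  simp

end Order

/-! ### Bounds for operators on C⋆-modules -/

namespace CStarModule

variable {A C E : Type*} [CStarAlgebra A] [CStarAlgebra C] [PartialOrder C]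
  [NormedAddCommGroup E] [NormedSpace ℂ E] [Module C E] [CStarModule C E]

theorem norm_smul_le (c : C) (x : E) : ‖c • x‖ ≤ ‖c‖ * ‖x‖ := by
  refine abs_le_of_sq_le_sq' ?_ (by positivity) |>.2
  calc ‖c • x‖ ^ 2 = ‖c * inner C x x * star c‖ := by
        rw [norm_sq_eq C, inner_op_smul_right, inner_op_smul_left, mul_assoc]
    _ ≤ ‖c‖ * ‖inner C x x‖ * ‖star c‖ := by
        grw [norm_mul_le, norm_mul_le]
    _ = (‖c‖ * ‖x‖) ^ 2 := by rw [← norm_sq_eq C, norm_star]; ring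

theorem uniformContinuousConstSMul : UniformContinuousConstSMul C E where
  uniformContinuous_const_smul c :=
    (AddMonoidHomClass.lipschitz_of_bound (DistribSMul.toAddMonoidHom E c) ‖c‖
      (norm_smul_le c)).uniformContinuous

variable [StarOrderedRing C]

section LeftAction

variable [Module A E] [IsScalarTower ℂ A E]

/-- A unital ⋆-representation of a C⋆-algebra by adjointable operators on a C⋆-module is
contractive: `‖a‖² ⟪x, x⟫ - ⟪a x, a x⟫ = ⟪c x, c x⟫` where `‖a‖² - a⋆a = c⋆c`. -/
theorem norm_smul_le_of_inner_smul_left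
    (h : ∀ (a : A) (x y : E), inner C (a • x) y = inner C x (star a • y)) (a : A) (x : E) :
    ‖a • x‖ ≤ ‖a‖ * ‖x‖ := by
  -- `A` carries no order of its own; the spectral order serves only to obtain `c`.
  let := CStarAlgebra.spectralOrder A
  let := CStarAlgebra.spectralOrderedRing A
  obtain ⟨c, hc⟩ := CStarAlgebra.exists_star_mul_self_add_eq_algebraMap a
  have key : inner C (c • x) (c • x) + inner C (a • x) (a • x) = (‖a‖ ^ 2) • inner C x x := by
    rw [h, h, smul_smul, smul_smul, ← inner_add_right, ← add_smul, hc, algebraMap_smul,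
      inner_smul_right_complex, ← Complex.ofReal_pow]
    exact Complex.coe_smul (‖a‖ ^ 2) (inner C x x)
  have hle : inner C (a • x) (a • x) ≤ (‖a‖ ^ 2) • inner C x x := by
    rw [← key]
    exact le_add_of_nonneg_left inner_self_nonneg
  refine abs_le_of_sq_le_sq' ?_ (by positivity) |>.2
  calc ‖a • x‖ ^ 2 = ‖inner C (a • x) (a • x)‖ := norm_sq_eq C
    _ ≤ ‖(‖a‖ ^ 2) • inner C x x‖ :=
        CStarAlgebra.norm_le_norm_of_nonneg_of_le inner_self_nonneg hle
    _ = (‖a‖ * ‖x‖) ^ 2 := by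
        rw [norm_smul, ← norm_sq_eq C, Real.norm_of_nonneg (by positivity), mul_pow]

theorem uniformContinuousConstSMul_of_inner_smul_left
    (h : ∀ (a : A) (x y : E), inner C (a • x) y = inner C x (star a • y)) :
    UniformContinuousConstSMul A E where
  uniformContinuous_const_smul a :=
    (AddMonoidHomClass.lipschitz_of_bound (DistribSMul.toAddMonoidHom E a) ‖a‖
      (norm_smul_le_of_inner_smul_left h a)).uniformContinuous

end LeftAction

/-- A symmetric contraction `J` satisfies the `C`-valued inequality `⟪Jx, Jx⟫ ≤ ⟪x, x⟫`: the
sequence `cₙ = ⟪Jⁿx, Jⁿx⟫` is convex, since `cₙ - 2cₙ₊₁ + cₙ₊₂` is the square of `Jⁿx - Jⁿ⁺²x`,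
and a bounded convex sequence is nonincreasing. -/
theorem inner_map_self_le {J : E → E} (hJ : ∀ x y, inner C (J x) y = inner C x (J y))
    (hJ' : ∀ x, ‖J x‖ ≤ ‖x‖) (x : E) : inner C (J x) (J x) ≤ inner C x x := by
  set c : ℕ → C := fun n => inner C (J^[n] x) (J^[n] x) with hc
  have convex (n : ℕ) : c (n + 1) - c n ≤ c (n + 2) - c (n + 1) := by
    have h : 0 ≤ inner C (J^[n] x - J^[n + 2] x) (J^[n] x - J^[n + 2] x) := inner_self_nonneg
    have h1 : inner C (J^[n] x) (J^[n + 2] x) = c (n + 1) := by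
      simp only [hc, Function.iterate_succ_apply', hJ]
    have h2 : inner C (J^[n + 2] x) (J^[n] x) = c (n + 1) := by
      simp only [hc, Function.iterate_succ_apply', hJ]
    rw [inner_sub_left, inner_sub_right, inner_sub_right, h1, h2] at h
    rw [← sub_nonneg]
    convert h using 1
    simp only [hc]
    abel
  have mono : Monotone fun n => c (n + 1) - c n := monotone_nat_of_le_succ convex
  have bound (n : ℕ) : n • (c 1 - c 0) ≤ c n - c 0 := by
    induction n with
    | zero => simp
    | succ n ih =>
      calc (n + 1) • (c 1 - c 0) = n • (c 1 - c 0) + (c 1 - c 0) := succ_nsmul ..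
        _ ≤ (c n - c 0) + (c (n + 1) - c n) := add_le_add ih (mono (Nat.zero_le n))
        _ = c (n + 1) - c 0 := by abel
  have hnorm (n : ℕ) : ‖J^[n] x‖ ≤ ‖x‖ := by
    induction n with
    | zero => simp
    | succ n ih => rw [Function.iterate_succ_apply']; exact (hJ' _).trans ih
  have hcn (n : ℕ) : ‖c n‖ ≤ ‖x‖ ^ 2 := by
    simp only [hc, ← norm_sq_eq C]
    gcongr
    exact hnorm n
  exact sub_nonpos.mp <| CStarAlgebra.nonpos_of_forall_nsmul_le (M := ‖x‖ ^ 2 + ‖x‖ ^ 2)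
    (fun n => (norm_sub_le _ _).trans (add_le_add (hcn n) (hcn 0))) bound

/-- For a symmetric contraction `J`, the inequality `⟪x - Jx, x - Jx⟫ ≥ 0` becomes
`2 ⟪x, Jx⟫ ≤ ⟪x, x⟫ + ⟪Jx, Jx⟫ ≤ 2 ⟪x, x⟫`. -/
theorem inner_map_le {J : E → E} (hJ : ∀ x y, inner C (J x) y = inner C x (J y))
    (hJ' : ∀ x, ‖J x‖ ≤ ‖x‖) (x : E) : inner C x (J x) ≤ inner C x x := by
  have h : 0 ≤ inner C (x - J x) (x - J x) := inner_self_nonneg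
  have h1 := inner_map_self_le hJ hJ' x
  rw [inner_sub_left, inner_sub_right, inner_sub_right, hJ x x] at h
  have h2 : (2 : ℝ) • inner C x (J x) ≤ (2 : ℝ) • inner C x x := by
    rw [two_smul, two_smul, ← sub_nonneg]
    have := add_nonneg h (sub_nonneg.mpr h1)
    convert this using 1
    abel
  exact le_of_smul_le_smul_left h2 two_pos

end CStarModule

/-! ### Completion of a C⋆-module -/

namespace UniformSpace.Completion

variable {C E : Type*} [CStarAlgebra C] [PartialOrder C] [StarOrderedRing C]
  [NormedAddCommGroup E] [NormedSpace ℂ E] [Module C E] [CStarModule C E]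

theorem cstarModule_inner_coe (x y : E) :
    inner C (x : Completion E) (y : Completion E) = inner C x y :=
  (isDenseInducing_coe.prodMap isDenseInducing_coe).extend_eq
    (CStarModule.continuous_inner : Continuous (Function.uncurry (inner C))) (x, y)

theorem continuous_cstarModule_inner :
    Continuous fun p : Completion E × Completion E => inner C p.1 p.2 := by
  let inner' : E →+ E →+ C :=
    { toFun := fun x => (CStarModule.innerₛₗ x : E →ₗ[ℂ] C).toAddMonoidHom
      map_zero' := by ext x; exact CStarModule.inner_zero_left
      map_add' := fun x y => by ext z; exact CStarModule.inner_add_left }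
  have : Continuous fun p : E × E => inner' p.1 p.2 := CStarModule.continuous_inner
  exact (isDenseInducing_toCompl E).extend_Z_bilin (isDenseInducing_toCompl E) this

theorem continuous_cstarModule_inner_comp {α : Type*} [TopologicalSpace α]
    {f g : α → Completion E} (hf : Continuous f) (hg : Continuous g) :
    Continuous fun x => inner C (f x) (g x) :=
  continuous_cstarModule_inner.comp (hf.prodMk hg)

variable [UniformContinuousConstSMul C E]

/-- The completion of a C⋆-module is a C⋆-module. -/
noncomputable instance instCStarModule : CStarModule C (Completion E) :=
  have hnorm (x : Completion E) : ‖x‖ = √‖inner C x x‖ :=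
    Completion.induction_on x
      (isClosed_eq continuous_norm
        (continuous_cstarModule_inner_comp continuous_id continuous_id).norm.sqrt)
      fun a => by
        rw [norm_coe, cstarModule_inner_coe, CStarModule.norm_eq_sqrt_norm_inner_self (A := C)]
  { inner_add_right := fun {x y z} =>
      Completion.induction_on₃ x y z
        (isClosed_eq
          (continuous_cstarModule_inner_comp continuous_fst
            (continuous_snd.fst.add continuous_snd.snd))
          ((continuous_cstarModule_inner_comp continuous_fst continuous_snd.fst).add
            (continuous_cstarModule_inner_comp continuous_fst continuous_snd.snd)))
        fun a b c => by
          simp only [← coe_add, cstarModule_inner_coe, CStarModule.inner_add_right]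
    inner_self_nonneg := fun {x} =>
      Completion.induction_on x
        (isClosed_le continuous_const
          (continuous_cstarModule_inner_comp continuous_id continuous_id))
        fun a => by
          rw [cstarModule_inner_coe]
          exact CStarModule.inner_self_nonneg
    inner_self := fun {x} => by
      rw [← norm_eq_zero, ← norm_eq_zero (a := x), hnorm x, Real.sqrt_eq_zero (norm_nonneg _)]
    inner_op_smul_right := fun {c x y} =>
      Completion.induction_on₂ x y
        (isClosed_eq
          (continuous_cstarModule_inner_comp continuous_fst (continuous_snd.const_smul c))
          ((continuous_cstarModule_inner_comp continuous_fst continuous_snd).const_mul c))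
        fun a b => by
          simp only [← coe_smul, cstarModule_inner_coe, CStarModule.inner_op_smul_right]
    inner_smul_right_complex := fun {c x y} =>
      Completion.induction_on₂ x y
        (isClosed_eq
          (continuous_cstarModule_inner_comp continuous_fst (continuous_snd.const_smul c))
          ((continuous_cstarModule_inner_comp continuous_fst continuous_snd).const_smul c))
        fun a b => by
          simp only [← coe_smul, cstarModule_inner_coe, CStarModule.inner_smul_right_complex]
    star_inner := fun x y =>
      Completion.induction_on₂ x y
        (isClosed_eq (continuous_cstarModule_inner_comp continuous_fst continuous_snd).star
          (continuous_cstarModule_inner_comp continuous_snd continuous_fst))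
        fun a b => by simp only [cstarModule_inner_coe, CStarModule.star_inner]
    norm_eq_sqrt_norm_inner_self := hnorm }

end UniformSpace.Completion

/-! ### Quotient of a semi-inner product module by its null space -/

/-- A semi-inner product on `V` with values in a C⋆-algebra `C`: a `C`-linear (in the second
variable), positive semidefinite sesquilinear form. Symmetry follows from positivity. -/
structure CStarSemiInnerForm (C V : Type*) [CStarAlgebra C] [PartialOrder C]
    [AddCommGroup V] [Module ℂ V] [Module C V] where
  form : V →ₗ⋆[ℂ] V →ₗ[ℂ] C
  form_smul_right : ∀ (c : C) (x y : V), form x (c • y) = c * form x y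
  form_self_nonneg : ∀ x : V, 0 ≤ form x x

namespace CStarSemiInnerForm

variable {C V : Type*} [CStarAlgebra C] [PartialOrder C]
  [AddCommGroup V] [Module ℂ V] [Module C V] (φ : CStarSemiInnerForm C V)

/-- The null space of a semi-inner product. -/
def nullSpace : Submodule C V where
  carrier := {x | ∀ y, φ.form y x = 0}
  add_mem' hx hy z := by rw [map_add, hx z, hy z, add_zero]
  zero_mem' z := map_zero _
  smul_mem' c x hx z := by rw [φ.form_smul_right, hx z, mul_zero]

theorem mem_nullSpace {x : V} : x ∈ φ.nullSpace ↔ ∀ y, φ.form y x = 0 := Iff.rfl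

/-- The quotient of `V` by the null space of a semi-inner product. -/
def Quot : Type _ := V ⧸ φ.nullSpace

namespace Quot

instance : AddCommGroup φ.Quot := inferInstanceAs (AddCommGroup (V ⧸ φ.nullSpace))

instance : Module C φ.Quot := inferInstanceAs (Module C (V ⧸ φ.nullSpace))

/-- The quotient map. -/
def mk : V →ₗ[C] φ.Quot := φ.nullSpace.mkQ

theorem mk_surjective : Function.Surjective (mk φ) := φ.nullSpace.mkQ_surjective

variable {φ} in
theorem mk_eq_mk {x y : V} : mk φ x = mk φ y ↔ ∀ z, φ.form z x = φ.form z y := by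
  refine (Submodule.Quotient.eq φ.nullSpace).trans ?_
  simp only [mem_nullSpace, map_sub, sub_eq_zero]

variable [IsScalarTower ℂ C V]

instance : Module ℂ φ.Quot := inferInstanceAs (Module ℂ (V ⧸ φ.nullSpace))

theorem mk_smul (z : ℂ) (x : V) : mk φ (z • x) = z • mk φ x := rfl

end Quot

variable [StarOrderedRing C]

/-- Symmetry, by polarization. -/
theorem star_form (x y : V) : star (φ.form x y) = φ.form y x := by
  have hself (z : V) : star (φ.form z z) = φ.form z z :=
    (IsSelfAdjoint.of_nonneg (φ.form_self_nonneg z)).star_eq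
  have h1 := hself (x + y)
  have h2 := hself (x + Complex.I • y)
  simp only [map_add, LinearMap.add_apply, LinearMap.neg_apply, star_add, hself, map_smul, map_smulₛₗ,
    LinearMap.smul_apply, star_smul, Complex.conj_I, Complex.star_def, neg_smul, smul_add, smul_neg,
    star_neg, neg_neg] at h1 h2
  have e1 : star (φ.form x y) + star (φ.form y x) = φ.form x y + φ.form y x := by
    rw [← sub_eq_zero] at h1 ⊢
    rw [← h1]
    abel
  have e2 : Complex.I • (star (φ.form y x) - star (φ.form x y)) =
      Complex.I • (φ.form x y - φ.form y x) := by
    rw [smul_sub, smul_sub]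
    rw [← sub_eq_zero] at h2 ⊢
    rw [← h2]
    abel
  have e3 := smul_right_injective C Complex.I_ne_zero e2
  have e4 : (2 : ℂ) • star (φ.form x y) = (2 : ℂ) • φ.form y x := by
    rw [two_smul, two_smul]
    rw [← sub_eq_zero] at e1 e3 ⊢
    calc _ = (star (φ.form x y) + star (φ.form y x) - (φ.form x y + φ.form y x)) -
          (star (φ.form y x) - star (φ.form x y) - (φ.form x y - φ.form y x)) := by abel
      _ = 0 := by rw [e1, e3, sub_zero]
  exact smul_right_injective C (two_ne_zero (α := ℂ)) e4

/-- A null vector is orthogonal to everything: expanding the form at `y - n • c • x` with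
`c = ⟪x, y⟫` gives `2n ⟪x, y⟫⟪x, y⟫⋆ ≤ ⟪y, y⟫` for all `n`. -/
theorem form_eq_zero_of_form_self_eq_zero {x : V} (hx : φ.form x x = 0) (y : V) :
    φ.form y x = 0 := by
  have left (c : C) (u v : V) : φ.form (c • u) v = φ.form u v * star c := by
    rw [← φ.star_form, φ.form_smul_right, star_mul, φ.star_form]
  set s := φ.form x y with hs
  have hyx : φ.form y x = star s := (φ.star_form x y).symm
  have key (n : ℕ) : n • (s * star s) ≤ φ.form y y := by
    have h := φ.form_self_nonneg (y - n • s • x)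
    simp only [map_sub, map_nsmul, LinearMap.sub_apply, LinearMap.smul_apply, φ.form_smul_right,
      left, hx, hyx, ← hs, mul_zero, zero_mul, smul_zero, sub_zero] at h
    have hn : 0 ≤ n • (s * star s) := nsmul_nonneg (mul_star_self_nonneg s) n
    exact sub_nonneg.mp (h.trans (sub_le_self _ hn))
  have h0 : s * star s = 0 :=
    le_antisymm (CStarAlgebra.nonpos_of_forall_nsmul_le (fun _ => le_rfl) key)
      (mul_star_self_nonneg s)
  rw [hyx, CStarRing.mul_star_self_eq_zero_iff _ |>.mp h0, star_zero]

namespace Quot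

/-- The inner product of two classes is the form evaluated at any representatives. -/
noncomputable instance : Inner C φ.Quot where
  inner x y :=
    φ.form (Function.surjInv (mk_surjective φ) x) (Function.surjInv (mk_surjective φ) y)

theorem inner_mk_mk (x y : V) : inner C (mk φ x) (mk φ y) = φ.form x y := by
  have h (z : V) : mk φ (Function.surjInv (mk_surjective φ) (mk φ z)) = mk φ z :=
    Function.surjInv_eq _ _
  calc φ.form _ (Function.surjInv (mk_surjective φ) (mk φ y))
      = φ.form _ y := mk_eq_mk.mp (h y) _
    _ = star (φ.form y _) := (φ.star_form _ _).symm
    _ = star (φ.form y x) := congrArg star (mk_eq_mk.mp (h x) y)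
    _ = φ.form x y := φ.star_form _ _

variable [IsScalarTower ℂ C V]

noncomputable instance : Norm φ.Quot := CStarModule.norm C

noncomputable instance : CStarModule C φ.Quot where
  inner_add_right {x y z} := by
    obtain ⟨x, rfl⟩ := mk_surjective φ x
    obtain ⟨y, rfl⟩ := mk_surjective φ y
    obtain ⟨z, rfl⟩ := mk_surjective φ z
    rw [← map_add, inner_mk_mk, inner_mk_mk, inner_mk_mk, map_add]
  inner_self_nonneg {x} := by
    obtain ⟨x, rfl⟩ := mk_surjective φ x
    rw [inner_mk_mk]
    exact φ.form_self_nonneg x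
  inner_self {x} := by
    obtain ⟨x, rfl⟩ := mk_surjective φ x
    rw [inner_mk_mk, ← map_zero (mk φ), mk_eq_mk]
    simp only [map_zero]
    exact ⟨fun h => φ.form_eq_zero_of_form_self_eq_zero h, fun h => h x⟩
  inner_op_smul_right {c x y} := by
    obtain ⟨x, rfl⟩ := mk_surjective φ x
    obtain ⟨y, rfl⟩ := mk_surjective φ y
    rw [← map_smul, inner_mk_mk, inner_mk_mk, φ.form_smul_right]
  inner_smul_right_complex {c x y} := by
    obtain ⟨x, rfl⟩ := mk_surjective φ x
    obtain ⟨y, rfl⟩ := mk_surjective φ y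
    rw [← mk_smul, inner_mk_mk, inner_mk_mk, map_smul]
  star_inner x y := by
    obtain ⟨x, rfl⟩ := mk_surjective φ x
    obtain ⟨y, rfl⟩ := mk_surjective φ y
    rw [inner_mk_mk, inner_mk_mk, φ.star_form]
  norm_eq_sqrt_norm_inner_self _ := rfl

noncomputable instance : NormedAddCommGroup φ.Quot := CStarModule.normedAddCommGroup C

noncomputable instance : NormedSpace ℂ φ.Quot := .ofCore (CStarModule.normedSpaceCore C)

end Quot

end CStarSemiInnerForm

/-! ### The sesquilinear form of a kernel -/

section KernelForm

variable {Y B : Type*} [CStarAlgebra B]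

/-- The sesquilinear form `⟪p, q⟫ = ∑ s t, p(s)⋆ κ(s, t) q(t)` of a `B`-valued kernel `κ` on finitely
supported functions. Its values lie in `Bᵐᵒᵖ`, over which `Y →₀ B` is a module by right
multiplication. -/
noncomputable def kernelForm (κ : Y → Y → B) : (Y →₀ B) →ₗ⋆[ℂ] (Y →₀ B) →ₗ[ℂ] Bᵐᵒᵖ :=
  LinearMap.mk₂'ₛₗ (starRingEnd ℂ) (RingHom.id ℂ)
    (fun p q => MulOpposite.op (p.sum fun s b => q.sum fun t d => star b * κ s t * d))
    (fun p p' q => by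
      rw [← MulOpposite.op_add, Finsupp.sum_add_index']
      · simp
      · intro s b b'
        simp only [star_add, add_mul, Finsupp.sum_add])
    (fun z p q => by
      rw [← MulOpposite.op_smul, Finsupp.sum_smul_index', Finsupp.smul_sum]
      · simp only [star_smul, smul_mul_assoc, Finsupp.smul_sum, Complex.star_def]
      · simp)
    (fun p q q' => by
      rw [← MulOpposite.op_add, ← Finsupp.sum_add]
      congr 2
      funext s b
      rw [Finsupp.sum_add_index']
      · simp
      · intros; rw [mul_add])
    (fun z p q => by
      rw [RingHom.id_apply, ← MulOpposite.op_smul, Finsupp.smul_sum]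
      congr 2
      funext s b
      rw [Finsupp.sum_smul_index', Finsupp.smul_sum]
      · simp only [mul_smul_comm]
      · simp)

theorem kernelForm_apply (κ : Y → Y → B) (p q : Y →₀ B) :
    kernelForm κ p q =
      MulOpposite.op (p.sum fun s b => q.sum fun t d => star b * κ s t * d) := rfl

theorem kernelForm_single_single (κ : Y → Y → B) (s t : Y) (b d : B) :
    kernelForm κ (Finsupp.single s b) (Finsupp.single t d) =
      MulOpposite.op (star b * κ s t * d) := by
  rw [kernelForm_apply, Finsupp.sum_single_index, Finsupp.sum_single_index] <;> simp

theorem kernelForm_smul_right (κ : Y → Y → B) (c : Bᵐᵒᵖ) (p q : Y →₀ B) :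
    kernelForm κ p (c • q) = c * kernelForm κ p q := by
  rw [kernelForm_apply, kernelForm_apply, ← MulOpposite.op_unop c, ← MulOpposite.op_mul,
    Finsupp.sum_mul]
  congr 2
  funext s b
  rw [Finsupp.sum_smul_index', Finsupp.sum_mul]
  · simp only [MulOpposite.smul_eq_mul_unop, mul_assoc, MulOpposite.op_unop]
  · simp

theorem kernelForm_mapDomain_right (κ : Y → Y → B) (f : Y → Y) (p q : Y →₀ B) :
    kernelForm κ p (q.mapDomain f) = kernelForm (fun s t => κ s (f t)) p q := by
  rw [kernelForm_apply, kernelForm_apply]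
  congr 2
  funext s b
  rw [Finsupp.sum_mapDomain_index]
  · simp
  · intros; rw [mul_add]

theorem kernelForm_mapDomain_left (κ : Y → Y → B) (f : Y → Y) (p q : Y →₀ B) :
    kernelForm κ (p.mapDomain f) q = kernelForm (fun s t => κ (f s) t) p q := by
  rw [kernelForm_apply, kernelForm_apply, Finsupp.sum_mapDomain_index]
  · simp
  · intros; simp only [star_add, add_mul, Finsupp.sum_add]

theorem kernelForm_add (κ κ' : Y → Y → B) (p q : Y →₀ B) :
    kernelForm (fun s t => κ s t + κ' s t) p q = kernelForm κ p q + kernelForm κ' p q := by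
  simp only [kernelForm_apply, mul_add, add_mul, Finsupp.sum_add, MulOpposite.op_add]

theorem kernelForm_smul (z : ℂ) (κ : Y → Y → B) (p q : Y →₀ B) :
    kernelForm (fun s t => z • κ s t) p q = z • kernelForm κ p q := by
  simp only [kernelForm_apply, mul_smul_comm, smul_mul_assoc, ← MulOpposite.op_smul,
    Finsupp.smul_sum]

end KernelForm

/-! ### Kolmogorov decomposition of a completely positive kernel -/

namespace OperatorKernel

variable {X : Type*} {A : Type*} {B : Type*} [CStarAlgebra A] [CStarAlgebra B]

/-- The `B`-valued kernel `((x, a), (y, a')) ↦ k(x, y)[a⋆ a']` on `X × A`. -/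
noncomputable def scalarKernel (k : OperatorKernel X A B) (s t : X × A) : B :=
  k s.1 t.1 (star s.2 * t.2)

/-- The left translation carrying the mass `b` at `(x, c)` to `(x, ac)`. It is additive in
`a` only modulo the null space of the semi-inner product. -/
noncomputable def leftTranslation (X : Type*) {A : Type*} (B : Type*) [CStarAlgebra A]
    [CStarAlgebra B] (a : A) : (X × A →₀ B) →ₗ[Bᵐᵒᵖ] (X × A →₀ B) :=
  Finsupp.lmapDomain B Bᵐᵒᵖ fun s => (s.1, a * s.2)

theorem kernelForm_leftTranslation_right (k : OperatorKernel X A B) (a : A) (p q : X × A →₀ B) :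
    kernelForm k.scalarKernel p (leftTranslation X B a q) =
      kernelForm (fun s t => k s.1 t.1 (star s.2 * (a * t.2))) p q :=
  kernelForm_mapDomain_right _ _ _ _

theorem kernelForm_leftTranslation_left (k : OperatorKernel X A B) (a : A) (p q : X × A →₀ B) :
    kernelForm k.scalarKernel (leftTranslation X B a p) q =
      kernelForm k.scalarKernel p (leftTranslation X B (star a) q) := by
  rw [kernelForm_leftTranslation_right]
  refine (kernelForm_mapDomain_left _ _ _ _).trans ?_
  simp only [scalarKernel, star_mul, mul_assoc]

variable [PartialOrder B]

theorem IsCompletelyPositive.kernelForm_self_nonneg {k : OperatorKernel X A B}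
    (hk : k.IsCompletelyPositive) (p : X × A →₀ B) :
    0 ≤ kernelForm k.scalarKernel p p := by
  let e := p.support.equivFin.symm
  have h := hk p.support.card (fun i => (e i).1.1) (fun i => (e i).1.2) (fun i => p (e i))
  rw [kernelForm_apply, MulOpposite.op_nonneg]
  convert h using 1
  rw [Finsupp.sum, ← Finset.sum_coe_sort, ← e.sum_comp]
  refine Finset.sum_congr rfl fun i _ => ?_
  rw [Finsupp.sum, ← Finset.sum_coe_sort, ← e.sum_comp]
  rfl

/-- The semi-inner product on `X × A →₀ B` given by a completely positive kernel. -/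
noncomputable def IsCompletelyPositive.semiInnerForm {k : OperatorKernel X A B}
    (hk : k.IsCompletelyPositive) : CStarSemiInnerForm Bᵐᵒᵖ (X × A →₀ B) where
  form := kernelForm k.scalarKernel
  form_smul_right := kernelForm_smul_right _
  form_self_nonneg := hk.kernelForm_self_nonneg

/-- The pre-Hilbert module of a completely positive kernel. -/
abbrev IsCompletelyPositive.PreModule {k : OperatorKernel X A B}
    (hk : k.IsCompletelyPositive) : Type _ := hk.semiInnerForm.Quot

namespace IsCompletelyPositive

open CStarSemiInnerForm.Quot

variable {k : OperatorKernel X A B} (hk : k.IsCompletelyPositive)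

theorem mk_eq_mk_iff {p q : X × A →₀ B} : mk hk.semiInnerForm p = mk hk.semiInnerForm q ↔
    ∀ r, kernelForm k.scalarKernel r p = kernelForm k.scalarKernel r q :=
  CStarSemiInnerForm.Quot.mk_eq_mk

theorem leftTranslation_mem_nullSpace (a : A) {p : X × A →₀ B}
    (hp : p ∈ hk.semiInnerForm.nullSpace) :
    leftTranslation X B a p ∈ hk.semiInnerForm.nullSpace := fun r => by
  change kernelForm k.scalarKernel r _ = 0
  rw [← star_star a, ← kernelForm_leftTranslation_left]
  exact hp _

/-- The operator of left multiplication by `a` on the pre-Hilbert module. -/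
noncomputable def lsmul (a : A) : hk.PreModule →ₗ[Bᵐᵒᵖ] hk.PreModule :=
  Submodule.mapQ _ _ (leftTranslation X B a) fun _ => hk.leftTranslation_mem_nullSpace a

theorem lsmul_mk (a : A) (p : X × A →₀ B) :
    hk.lsmul a (mk hk.semiInnerForm p) = mk hk.semiInnerForm (leftTranslation X B a p) := rfl

theorem lsmul_one (x : hk.PreModule) : hk.lsmul 1 x = x := by
  obtain ⟨p, rfl⟩ := mk_surjective _ x
  rw [lsmul_mk, mk_eq_mk_iff]
  intro r
  rw [kernelForm_leftTranslation_right]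
  simp only [one_mul]
  rfl

theorem lsmul_mul (a a' : A) (x : hk.PreModule) :
    hk.lsmul (a * a') x = hk.lsmul a (hk.lsmul a' x) := by
  obtain ⟨p, rfl⟩ := mk_surjective _ x
  simp only [lsmul_mk, mk_eq_mk_iff]
  intro r
  rw [← star_star a, ← kernelForm_leftTranslation_left, kernelForm_leftTranslation_right,
    kernelForm_leftTranslation_right]
  refine Eq.trans ?_ (kernelForm_mapDomain_left _ _ _ _).symm
  simp only [star_mul, star_star, mul_assoc]

theorem lsmul_add (a a' : A) (x : hk.PreModule) :
    hk.lsmul (a + a') x = hk.lsmul a x + hk.lsmul a' x := by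
  obtain ⟨p, rfl⟩ := mk_surjective _ x
  simp only [lsmul_mk, ← map_add, mk_eq_mk_iff]
  intro r
  simp only [map_add, kernelForm_leftTranslation_right, ← kernelForm_add, add_mul, mul_add]

theorem lsmul_smul (z : ℂ) (a : A) (x : hk.PreModule) :
    hk.lsmul (z • a) x = z • hk.lsmul a x := by
  obtain ⟨p, rfl⟩ := mk_surjective _ x
  simp only [lsmul_mk, ← mk_smul, mk_eq_mk_iff]
  intro r
  simp only [map_smul, kernelForm_leftTranslation_right, ← kernelForm_smul, smul_mul_assoc,
    mul_smul_comm]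

noncomputable instance : Module A hk.PreModule where
  smul a x := hk.lsmul a x
  one_smul := hk.lsmul_one
  mul_smul := hk.lsmul_mul
  smul_zero a := map_zero (hk.lsmul a)
  smul_add a := map_add (hk.lsmul a)
  add_smul := hk.lsmul_add
  zero_smul x := by
    have h := hk.lsmul_add 0 0 x
    rwa [add_zero, left_eq_add] at h

instance : IsScalarTower ℂ A hk.PreModule := ⟨hk.lsmul_smul⟩

instance : SMulCommClass A Bᵐᵒᵖ hk.PreModule := ⟨fun a => map_smul (hk.lsmul a)⟩

theorem smul_mk (a : A) (p : X × A →₀ B) :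
    a • mk hk.semiInnerForm p = mk hk.semiInnerForm (leftTranslation X B a p) := rfl

variable [StarOrderedRing B]

theorem inner_smul_left (a : A) (x y : hk.PreModule) :
    inner Bᵐᵒᵖ (a • x) y = inner Bᵐᵒᵖ x (star a • y) := by
  obtain ⟨p, rfl⟩ := mk_surjective _ x
  obtain ⟨q, rfl⟩ := mk_surjective _ y
  rw [smul_mk, smul_mk, inner_mk_mk, inner_mk_mk]
  exact kernelForm_leftTranslation_left k a p q

instance : UniformContinuousConstSMul A hk.PreModule :=
  CStarModule.uniformContinuousConstSMul_of_inner_smul_left hk.inner_smul_left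

instance : UniformContinuousConstSMul Bᵐᵒᵖ hk.PreModule :=
  CStarModule.uniformContinuousConstSMul

/-- The Kolmogorov correspondence of a completely positive kernel `k`: the completion of its
pre-Hilbert module. -/
noncomputable def correspondence : Correspondence A B where
  carrier := UniformSpace.Completion hk.PreModule
  inner_smul_left' a e f :=
    UniformSpace.Completion.induction_on₂ e f
      (isClosed_eq
        (UniformSpace.Completion.continuous_cstarModule_inner_comp
          (continuous_fst.const_smul a) continuous_snd)
        (UniformSpace.Completion.continuous_cstarModule_inner_comp
          continuous_fst (continuous_snd.const_smul (star a))))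
      fun x y => by
        rw [← UniformSpace.Completion.coe_smul, ← UniformSpace.Completion.coe_smul,
          UniformSpace.Completion.cstarModule_inner_coe,
          UniformSpace.Completion.cstarModule_inner_coe, hk.inner_smul_left]

/-- The map sending `x` to the class of the unit mass at `(x, 1)`. -/
noncomputable def embedding (x : X) : hk.correspondence :=
  ((mk hk.semiInnerForm (Finsupp.single (x, 1) 1) : hk.PreModule) :
    UniformSpace.Completion hk.PreModule)

/-- The Kolmogorov decomposition of a completely positive kernel. -/
theorem apply_eq_ip_embedding (x y : X) (a : A) :
    k x y a = hk.correspondence.ip (a • hk.embedding y) (hk.embedding x) := by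
  have h : inner Bᵐᵒᵖ (mk hk.semiInnerForm (Finsupp.single (x, 1) 1))
      (a • mk hk.semiInnerForm (Finsupp.single (y, 1) 1)) = MulOpposite.op (k x y a) := by
    rw [smul_mk, inner_mk_mk]
    refine (kernelForm_leftTranslation_right k a _ _).trans ?_
    rw [kernelForm_single_single]
    simp
  rw [← MulOpposite.unop_op (k x y a), ← h, ← UniformSpace.Completion.cstarModule_inner_coe,
    UniformSpace.Completion.coe_smul]
  rfl

end IsCompletelyPositive

end OperatorKernel

/-! ### Correspondences, their kernels and direct sums -/

namespace Correspondence

open scoped WithCStarModule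

variable {A : Type v} {B : Type w} [CStarAlgebra A] [CStarAlgebra B]
  [PartialOrder B] [StarOrderedRing B]

theorem norm_smul_le (E : Correspondence.{v, w, t} A B) (a : A) (e : E) :
    ‖a • e‖ ≤ ‖a‖ * ‖e‖ :=
  CStarModule.norm_smul_le_of_inner_smul_left E.inner_smul_left' a e

theorem norm_ip_le (E : Correspondence.{v, w, t} A B) (e f : E) :
    ‖E.ip e f‖ ≤ ‖e‖ * ‖f‖ :=
  (CStarModule.norm_inner_le E (A := Bᵐᵒᵖ)).trans_eq (mul_comm _ _)

theorem ip_add_left (E : Correspondence.{v, w, t} A B) (e e' f : E) :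
    E.ip (e + e') f = E.ip e f + E.ip e' f := by
  simp [ip]

theorem ip_sum_left (E : Correspondence.{v, w, t} A B) {ι : Type*} (s : Finset ι) (e : ι → E)
    (f : E) : E.ip (∑ i ∈ s, e i) f = ∑ i ∈ s, E.ip (e i) f := by
  simp [ip]

theorem ip_sum_right (E : Correspondence.{v, w, t} A B) {ι : Type*} (s : Finset ι) (e : E)
    (f : ι → E) : E.ip e (∑ i ∈ s, f i) = ∑ i ∈ s, E.ip e (f i) := by
  simp [ip]

theorem ip_sub_right (E : Correspondence.{v, w, t} A B) (e f f' : E) :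
    E.ip e (f - f') = E.ip e f - E.ip e f' := by
  simp [ip]

theorem ip_neg_right (E : Correspondence.{v, w, t} A B) (e f : E) :
    E.ip e (-f) = -E.ip e f := by
  simp [ip]

theorem ip_smul_complex_left (E : Correspondence.{v, w, t} A B) (z : ℂ) (e f : E) :
    E.ip (z • e) f = z • E.ip e f := by
  simp [ip]

theorem ip_smul_right (E : Correspondence.{v, w, t} A B) (e f : E) (b : B) :
    E.ip e (f <• b) = star b * E.ip e f := by
  simp [ip]

theorem ip_left_smul (E : Correspondence.{v, w, t} A B) (a : A) (e f : E) :
    E.ip (a • e) f = E.ip e (star a • f) := by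
  rw [← star_ip, ip, ip, ← MulOpposite.unop_star, CStarModule.star_inner, ← star_star a,
    ← E.inner_smul_left', star_star]

theorem ip_self_nonneg (E : Correspondence.{v, w, t} A B) (e : E) : 0 ≤ E.ip e e :=
  MulOpposite.unop_nonneg.mpr CStarModule.inner_self_nonneg

theorem IsSelfAdjointMap.ip_map_le {E : Correspondence.{v, w, t} A B} {J : E →ₗ[A] E}
    (hJ : E.IsSelfAdjointMap J) (hJ' : E.IsContractiveMap J) (e : E) :
    E.ip e (J e) ≤ E.ip e e := by
  have hsymm (x y : E) : inner Bᵐᵒᵖ (J x) y = inner Bᵐᵒᵖ x (J y) :=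
    MulOpposite.unop_injective (hJ y x).symm
  rw [← hJ e e]
  exact MulOpposite.unop_le_unop.mpr (CStarModule.inner_map_le hsymm hJ' e)

/-- The bounded kernel `(x, y) ↦ (a ↦ ⟨a ι(y), T ι(x)⟩)`. -/
noncomputable def kernel (E : Correspondence.{v, w, t} A B) {X : Type u} (T : E →ₗ[A] E)
    (ι : X → E) : OperatorKernel X A B := fun x y =>
  LinearMap.mkContinuous
    { toFun := fun a => E.ip (a • ι y) (T (ι x))
      map_add' := fun a a' => by rw [add_smul, ip_add_left]
      map_smul' := fun z a => by rw [smul_assoc, ip_smul_complex_left, RingHom.id_apply] }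
    (‖ι y‖ * ‖T (ι x)‖) fun a => by
      calc ‖E.ip (a • ι y) (T (ι x))‖ ≤ ‖a • ι y‖ * ‖T (ι x)‖ := E.norm_ip_le _ _
        _ ≤ ‖a‖ * ‖ι y‖ * ‖T (ι x)‖ := by grw [E.norm_smul_le]
        _ = ‖ι y‖ * ‖T (ι x)‖ * ‖a‖ := by ring

theorem kernel_apply (E : Correspondence.{v, w, t} A B) {X : Type u} (T : E →ₗ[A] E)
    (ι : X → E) (x y : X) (a : A) : E.kernel T ι x y a = E.ip (a • ι y) (T (ι x)) := rfl

/-- The kernel of a positive module map `T` is completely positive: the defining sum equals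
`⟨s, T s⟩` for `s = ∑ᵢ aᵢ ι(xᵢ) bᵢ`. -/
theorem isCompletelyPositive_kernel {E : Correspondence.{v, w, t} A B} {X : Type u}
    {T : E →ₗ[A] E} (hT : E.IsSelfAdjointMap T) (hpos : ∀ e, 0 ≤ E.ip e (T e)) (ι : X → E) :
    (E.kernel T ι).IsCompletelyPositive := by
  intro n x a b
  set s : Fin n → E := fun i => (a i • ι (x i)) <• b i with hs
  have term (i j : Fin n) : star (b i) * E.kernel T ι (x i) (x j) (star (a i) * a j) * b j =
      E.ip (T (s j)) (s i) := by
    rw [kernel_apply, mul_assoc, ← ip_smul_left, ← hT, ← smul_comm (star (a i) * a j), mul_smul,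
      map_smul, ip_left_smul, star_star, ← ip_smul_right, smul_comm (a j)]
  simp only [term]
  have h := hpos (∑ i, s i)
  rw [← hT, map_sum, ip_sum_right] at h
  simpa only [ip_sum_left] using h

/-- The orthogonal direct sum of two correspondences. -/
noncomputable def prod (E F : Correspondence.{v, w, t} A B) : Correspondence.{v, w, t} A B where
  carrier := C⋆ᵐᵒᵈ(Bᵐᵒᵖ, E × F)
  inner_smul_left' a e f := by
    simp only [WithCStarModule.prod_inner, WithCStarModule.smul_fst, WithCStarModule.smul_snd,
      E.inner_smul_left', F.inner_smul_left']

/-- The symmetry `(e, f) ↦ (e, -f)` of a direct sum. -/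
noncomputable def prodSymmetry (E F : Correspondence.{v, w, t} A B) :
    E.prod F →ₗ[A] E.prod F :=
  (LinearMap.id.prodMap (-LinearMap.id) : E × F →ₗ[A] E × F)

/-- The vector `(e, f)` of a direct sum. -/
def prodMk {E F : Correspondence.{v, w, t} A B} (e : E) (f : F) : E.prod F :=
  (WithCStarModule.equiv Bᵐᵒᵖ (E × F)).symm (e, f)

theorem exists_eq_prodMk {E F : Correspondence.{v, w, t} A B} (x : E.prod F) :
    ∃ e f, x = prodMk e f := ⟨x.1, x.2, rfl⟩

theorem ip_prodMk {E F : Correspondence.{v, w, t} A B} (e e' : E) (f f' : F) :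
    (E.prod F).ip (prodMk e f) (prodMk e' f') = E.ip e e' + F.ip f f' := rfl

theorem smul_prodMk {E F : Correspondence.{v, w, t} A B} (a : A) (e : E) (f : F) :
    a • prodMk e f = prodMk (a • e) (a • f) := rfl

theorem prodSymmetry_prodMk {E F : Correspondence.{v, w, t} A B} (e : E) (f : F) :
    E.prodSymmetry F (prodMk e f) = prodMk e (-f) := rfl

theorem norm_eq_sqrt_norm_ip_self (E : Correspondence.{v, w, t} A B) (e : E) :
    ‖e‖ = √‖E.ip e e‖ :=
  CStarModule.norm_eq_sqrt_norm_inner_self (A := Bᵐᵒᵖ) e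

theorem prodSymmetry_isSelfAdjointMap (E F : Correspondence.{v, w, t} A B) :
    (E.prod F).IsSelfAdjointMap (E.prodSymmetry F) := by
  intro x y
  obtain ⟨e, f, rfl⟩ := exists_eq_prodMk x
  obtain ⟨e', f', rfl⟩ := exists_eq_prodMk y
  rw [prodSymmetry_prodMk, prodSymmetry_prodMk, ip_prodMk, ip_prodMk, ip_neg_right, ← star_ip F f',
    ip_neg_right, star_neg, star_ip]

theorem prodSymmetry_comp_self (E F : Correspondence.{v, w, t} A B) :
    E.prodSymmetry F ∘ₗ E.prodSymmetry F = LinearMap.id := by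
  ext x
  obtain ⟨e, f, rfl⟩ := exists_eq_prodMk x
  rw [LinearMap.comp_apply, prodSymmetry_prodMk, prodSymmetry_prodMk, neg_neg, LinearMap.id_apply]

/-- A self-adjoint involution is isometric. -/
theorem IsSelfAdjointMap.isContractiveMap {E : Correspondence.{v, w, t} A B} {J : E →ₗ[A] E}
    (hJ : E.IsSelfAdjointMap J) (hJ' : J ∘ₗ J = LinearMap.id) : E.IsContractiveMap J := fun e => by
  rw [norm_eq_sqrt_norm_ip_self, norm_eq_sqrt_norm_ip_self, hJ, ← LinearMap.comp_apply, hJ',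
    LinearMap.id_apply]

end Correspondence

/-! ### Decomposable kernels -/

namespace OperatorKernel

variable {X : Type u} {A : Type v} {B : Type w} [CStarAlgebra A] [CStarAlgebra B]
  [PartialOrder B]

theorem IsCompletelyPositive.comp {k : OperatorKernel X A B} (hk : k.IsCompletelyPositive)
    {Z : Type*} (f : Z → X) :
    IsCompletelyPositive (X := Z) fun x y => k (f x) (f y) :=
  fun n x => hk n fun i => f (x i)

end OperatorKernel

theorem mainTheorem2 {X : Type u} {A : Type v} {B : Type w} [CStarAlgebra A] [CStarAlgebra B]
    [PartialOrder B] [StarOrderedRing B] (k : OperatorKernel X A B) :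
    List.TFAE [
      k.IsDecomposable,
      ∃ L : OperatorKernel X A B, L.IsCompletelyPositive ∧ k.KernelLE L,
      ∃ L : OperatorKernel X A B, L.IsCompletelyPositive ∧ (-L).KernelLE k ∧ k.KernelLE L,
      ∃ (E : Correspondence.{v, w, max u v w t} A B) (J : E →ₗ[A] E) (ι : X → E),
        E.IsSelfAdjointMap J ∧ E.IsContractiveMap J ∧
          ∀ (x y : X) (a : A), k x y a = E.ip (a • ι y) (J (ι x)),
      ∃ (E : Correspondence.{v, w, max u v w t} A B) (J : E →ₗ[A] E) (ι : X → E),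
        E.IsSelfAdjointMap J ∧ E.IsContractiveMap J ∧ J ∘ₗ J = LinearMap.id ∧
          ∀ (x y : X) (a : A), k x y a = E.ip (a • ι y) (J (ι x))] := by
  tfae_have 1 → 5 := by
    rintro ⟨k₁, k₂, h₁, h₂, rfl⟩
    -- Lifting the index set to `Type (max u t)` puts the correspondences in the required universe.
    have h₁' := h₁.comp (ULift.down : ULift.{t} X → X)
    have h₂' := h₂.comp (ULift.down : ULift.{t} X → X)
    have hJ := h₁'.correspondence.prodSymmetry_isSelfAdjointMap h₂'.correspondence
    have hJ' := h₁'.correspondence.prodSymmetry_comp_self h₂'.correspondence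
    refine ⟨h₁'.correspondence.prod h₂'.correspondence, _,
      fun x => Correspondence.prodMk (h₁'.embedding ⟨x⟩) (h₂'.embedding ⟨x⟩),
      hJ, hJ.isContractiveMap hJ', hJ', fun x y a => ?_⟩
    rw [Correspondence.smul_prodMk, Correspondence.prodSymmetry_prodMk, Correspondence.ip_prodMk,
      Correspondence.ip_neg_right, ← h₁'.apply_eq_ip_embedding, ← h₂'.apply_eq_ip_embedding,
      ← sub_eq_add_neg]
    rfl
  tfae_have 5 → 4 := by
    rintro ⟨E, J, ι, hJ, hJ', -, h⟩
    exact ⟨E, J, ι, hJ, hJ', h⟩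
  tfae_have 4 → 3 := by
    rintro ⟨E, J, ι, hJ, hJ', h⟩
    have hneg : E.IsSelfAdjointMap (-J) := fun e f => by
      rw [LinearMap.neg_apply, LinearMap.neg_apply, Correspondence.ip_neg_right, ← hJ,
        ← E.star_ip f, Correspondence.ip_neg_right, star_neg, E.star_ip]
    have hneg' : E.IsContractiveMap (-J) := fun e => by
      rw [LinearMap.neg_apply, norm_neg]
      exact hJ' e
    have hid : E.IsSelfAdjointMap LinearMap.id := fun _ _ => rfl
    -- `L ∓ k` is the kernel of the positive map `1 ∓ J`.
    have hsub {T : E →ₗ[A] E} (hT : E.IsSelfAdjointMap T) (hT' : E.IsContractiveMap T) :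
        (E.kernel (LinearMap.id - T) ι).IsCompletelyPositive := by
      refine Correspondence.isCompletelyPositive_kernel (fun e f => ?_) (fun e => ?_) ι
      · rw [LinearMap.sub_apply, LinearMap.sub_apply, Correspondence.ip_sub_right, ← hT, ← hid,
          ← E.star_ip f, Correspondence.ip_sub_right, star_sub, E.star_ip, E.star_ip]
      · rw [LinearMap.sub_apply, Correspondence.ip_sub_right]
        exact sub_nonneg.mpr (hT.ip_map_le hT' e)
    refine ⟨E.kernel LinearMap.id ι,
      Correspondence.isCompletelyPositive_kernel hid E.ip_self_nonneg ι, ?_, ?_⟩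
    · suffices heq : k - -E.kernel LinearMap.id ι = E.kernel (LinearMap.id - -J) ι by
        rw [OperatorKernel.KernelLE, heq]
        exact hsub hneg hneg'
      ext x y a
      change k x y a - -E.kernel LinearMap.id ι x y a = _
      simp only [Correspondence.kernel_apply, h, LinearMap.sub_apply, LinearMap.neg_apply,
        Correspondence.ip_sub_right, Correspondence.ip_neg_right]
      abel
    · suffices heq : E.kernel LinearMap.id ι - k = E.kernel (LinearMap.id - J) ι by
        rw [OperatorKernel.KernelLE, heq]
        exact hsub hJ hJ'
      ext x y a
      change E.kernel LinearMap.id ι x y a - k x y a = _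
      simp only [Correspondence.kernel_apply, h, LinearMap.sub_apply,
        Correspondence.ip_sub_right]
  tfae_have 3 → 2 := by
    rintro ⟨L, hL, -, h⟩
    exact ⟨L, hL, h⟩
  tfae_have 2 → 1 := by
    rintro ⟨L, hL, h⟩
    exact ⟨L, L - k, hL, h, (sub_sub_cancel L k).symm⟩
  tfae_finish
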